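/- **Theorem 4.4.** Let $r,n,m\ge 0$ be integers with $n\ge m$, let $I,J\subseteq\{1,\dots,r\}$ be subsets with $|I|=|J|=m$, and put $c=|I\cap J|\ge 0$ (possibly $c=0$). Let $W\sim\mathcal W_r(n,I_r)$ be a standard Wishart matrix, that is, $W$ has the law of $XX^T$ where $X$ is an $r\times n$ matrix whose columns are independent $\mathcal N_r(0,I_r)$ random vectors, and let $\det(W_{I\times J})$ be the minor of $W$ with rows in $I$ and columns in $J$, both listed in increasing order. Then $$\det(W_{I\times J})\ \sim\ \Big(\prod_{i=1}^{c}W_i\Big)\Big(\prod_{i=c+1}^{m}\sqrt{W_i}\Big)\det(Z),$$ where $\sim$ denotes equality in distribution, $W_1,\dots,W_m$ are independent random variables with $W_i\sim\chi^2_{n-i+1}$, and $Z=(Z_{ij})$ is an $(m-c)\times(m-c)$ random matrix of independent $\mathcal N(0,1)$ random variables that is independent of $(W_1,\dots,W_m)$ (empty products and the determinant of the $0\times 0$ matrix are $1$). In particular, $\det(W_{I\times J})$ is square-integrable, $$\mathbb E[\det(W_{I\times J})^2]=\frac{n!}{(n-m)!}\,\frac{(n+2)!}{(n+2-c)!}\,(m-c)!,$$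 and $$\operatorname{Var}[\det(W_{I\times J})]=\begin{cases}\dfrac{n!}{(n-m)!}\left[\dfrac{(n+2)!}{(n+2-m)!}-\dfrac{n!}{(n-m)!}\right],&\text{if } I=J,\\[2ex]\dfrac{n!}{(n-m)!}\,\dfrac{(n+2)!}{(n+2-c)!}\,(m-c)!,&\text{if } c<m.\end{cases}$$ -/

import Mathlib

open MeasureTheory ProbabilityTheory
open scoped Nat

noncomputable section

/-- The product (entrywise) measurable structure on matrices. -/
instance Matrix.instMeasurableSpaceEntries {m n α : Type*} [MeasurableSpace α] :
    MeasurableSpace (Matrix m n α) :=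
  inferInstanceAs (MeasurableSpace (m → n → α))

/-- The Wishart distribution `𝒲_r(n, Σ)` with scale matrix `S = Σ` and `n` degrees of freedom: the
law of `X Xᵀ`, where the `n` columns of the `r × n` matrix `X` are independent `𝒩_r(0, Σ)`
vectors. Here `x k` is the `k`-th column of `X`. -/
def wishartMeasure (r n : ℕ) (S : Matrix (Fin r) (Fin r) ℝ) :
    Measure (Matrix (Fin r) (Fin r) ℝ) :=
  (Measure.pi fun _ : Fin n => multivariateGaussian (0 : EuclideanSpace ℝ (Fin r)) S).map
    fun x => (Matrix.of fun i k => x k i) * (Matrix.of fun i k => x k i).transpose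

/-- The chi-square distribution `χ²_k` with `k` degrees of freedom: the law of the sum of squares
of `k` independent standard normal random variables. -/
def chiSquareMeasure (k : ℕ) : Measure ℝ :=
  (Measure.pi fun _ : Fin k => gaussianReal 0 1).map fun x => ∑ i, x i ^ 2

/-- The `m × m` minor `det(A_{I × J})`: the determinant of the submatrix of `A` with rows in `I` and
columns in `J`, both listed in increasing order. -/
def minorDet {r m : ℕ} (A : Matrix (Fin r) (Fin r) ℝ) (I J : Finset (Fin r))
    (hI : I.card = m) (hJ : J.card = m) : ℝ :=
  (A.submatrix (I.orderEmbOfFin hI) (J.orderEmbOfFin hJ)).det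

end

/-! A standard Wishart matrix is the Gram matrix of `r` independent standard Gaussian vectors in
`ℝⁿ`, the rows of the data matrix. Let `A` be the `c` vectors indexed by `I ∩ J`, `B` those of `I \
J` and `C` those of `J \ I`. Up to a sign from reordering, the minor is the determinant of the inner
products of `(A, B)` with `(A, C)`.

Fix `A` and `C`, and take an orthonormal basis adapted to the flag span `A` ⊆ span `(A, C)`. The
matrix factors as a block triangular matrix with diagonal blocks `T₁` (coordinates of `A`) and `Z`
(middle coordinates of `B`), times the transpose of the coordinate matrix `T` of `(A, C)`. Here `Z`
is a standard Gaussian matrix whatever `A` and `C` are, and `|det T₁ · det T| = √(G(A) G(A, C))`,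
where `G` is the Gram determinant. The sign is absorbed by the symmetry of the law of `det Z`
(`map_det_cross_gram`).

Adding an independent Gaussian vector to `j` vectors multiplies `G` by a squared distance with law
`χ²_{n-j}` (`map_det_gram_sumElim`). Hence `G(A)` is the product of the first `c` chi-squares and
`G(A, C)` the product of all `m`, so the square root leaves the first `c` factors whole and puts
roots on the others. The moments follow by independence, with `E[det Z²] = (m - c)!` coming from the
same Gram determinant law. -/

/-! ### Images and rearrangements of product measures. -/

/-- Two product measures have the same image if the images of all sections agree. -/
theorem map_prod_eq_of_forall_map_eq {α β β' γ : Type*} [MeasurableSpace α] [MeasurableSpace β]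
    [MeasurableSpace β'] [MeasurableSpace γ] (μ : Measure α) (ν : Measure β) (ν' : Measure β')
    [SFinite ν] [SFinite ν'] {f : α × β → γ} {f' : α × β' → γ}
    (hf : Measurable f) (hf' : Measurable f')
    (h : ∀ a, ν.map (fun b => f (a, b)) = ν'.map (fun b => f' (a, b))) :
    (μ.prod ν).map f = (μ.prod ν').map f' := by
  ext s hs
  rw [Measure.map_apply hf hs, Measure.map_apply hf' hs, Measure.prod_apply (hf hs),
    Measure.prod_apply (hf' hs)]
  refine lintegral_congr fun a => ?_
  have := congrArg (fun m => m s) (h a)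
  rw [Measure.map_apply (by fun_prop) hs, Measure.map_apply (by fun_prop) hs] at this
  exact this

/-- Restricting a product measure along an injection of the index set. -/
theorem measurePreserving_pi_comp_injective {ι κ : Type*} [Fintype ι] [Fintype κ] {X : Type*}
    [MeasurableSpace X] (μ : ι → Measure X) [∀ i, IsProbabilityMeasure (μ i)] {e : κ → ι}
    (he : Function.Injective e) :
    MeasurePreserving (fun (x : ι → X) k => x (e k)) (Measure.pi μ)
      (Measure.pi fun k => μ (e k)) where
  measurable := by fun_prop
  map_eq := by
    have h := (iIndepFun_pi (μ := μ) (X := fun _ x => x) (fun i => by fun_prop)).precomp he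
    rw [iIndepFun_iff_map_fun_eq_pi_map (fun i => (measurable_pi_apply _).aemeasurable)] at h
    rw [h]
    congr 1
    funext k
    exact (measurePreserving_eval μ (e k)).map_eq

theorem measurePreserving_curry {ι κ X : Type*} [Fintype ι] [Fintype κ] [MeasurableSpace X]
    (μ : Measure X) [IsProbabilityMeasure μ] :
    MeasurePreserving (fun (x : ι × κ → X) i k => x (i, k)) (Measure.pi fun _ => μ)
      (Measure.pi fun _ => Measure.pi fun _ => μ) where
  measurable := by fun_prop
  map_eq := by
    have := Measure.infinitePi_map_curry (fun (_ : ι) (_ : κ) => μ)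
    simp only [Measure.infinitePi_eq_pi] at this
    exact this

/-- Transposing the data matrix: this turns independent Gaussian columns into independent Gaussian
rows. -/
theorem measurePreserving_pi_swap {ι κ X : Type*} [Fintype ι] [Fintype κ] [MeasurableSpace X]
    (μ : Measure X) [IsProbabilityMeasure μ] :
    MeasurePreserving (fun (x : ι → κ → X) k i => x i k) (Measure.pi fun _ => Measure.pi fun _ => μ)
      (Measure.pi fun _ => Measure.pi fun _ => μ) where
  measurable := by fun_prop
  map_eq := by
    rw [← (measurePreserving_curry (ι := ι) (κ := κ) μ).map_eq,
      Measure.map_map (by fun_prop) (by fun_prop),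
      ← (measurePreserving_curry (ι := κ) (κ := ι) μ).map_eq,
      ← (measurePreserving_pi_comp_injective (fun _ : ι × κ => μ)
        (e := Prod.swap (α := κ) (β := ι)) Prod.swap_injective).map_eq,
      Measure.map_map (by fun_prop) (by fun_prop)]
    rfl

theorem measurePreserving_pi_sum {ι κ X : Type*} [Fintype ι] [Fintype κ] [MeasurableSpace X]
    (μ : ι ⊕ κ → Measure X) [∀ i, SigmaFinite (μ i)] :
    MeasurePreserving (fun (x : ι ⊕ κ → X) => (fun i => x (.inl i), fun k => x (.inr k)))
      (Measure.pi μ)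
      ((Measure.pi fun i => μ (.inl i)).prod (Measure.pi fun k => μ (.inr k))) :=
  measurePreserving_sumPiEquivProdPi μ

theorem measurePreserving_pi_map {ι X Y : Type*} [Fintype ι] [MeasurableSpace X]
    [MeasurableSpace Y] {μ : ι → Measure X} {ν : ι → Measure Y} [∀ i, SigmaFinite (ν i)]
    {f : ι → X → Y} (h : ∀ i, MeasurePreserving (f i) (μ i) (ν i)) :
    MeasurePreserving (fun (x : ι → X) i => f i (x i)) (Measure.pi μ) (Measure.pi ν) where
  measurable := by
    have := fun i => (h i).measurable
    fun_prop
  map_eq := by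
    have : ∀ i, SigmaFinite ((μ i).map (f i)) := fun i => by rw [(h i).map_eq]; infer_instance
    rw [Measure.pi_map_pi fun i => (h i).aemeasurable]
    simp_rw [(h _).map_eq]

/-! ### Moments of the Gaussian and chi-square laws. -/

instance isProbabilityMeasure_chiSquareMeasure (k : ℕ) :
    IsProbabilityMeasure (chiSquareMeasure k) :=
  Measure.isProbabilityMeasure_map (Measurable.aemeasurable (by fun_prop))

theorem ae_nonneg_chiSquareMeasure (k : ℕ) : ∀ᵐ v ∂chiSquareMeasure k, 0 ≤ v := by
  rw [chiSquareMeasure, ae_map_iff (Measurable.aemeasurable (by fun_prop)) measurableSet_Ici]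
  exact .of_forall fun x => Finset.sum_nonneg fun i _ => sq_nonneg _

theorem integrable_pow_gaussianReal (n : ℕ) (m : ℝ) (v : NNReal) :
    Integrable (fun x => x ^ n) (gaussianReal m v) := by
  have h := (memLp_id_gaussianReal (μ := m) (v := v) n).integrable_norm_pow'
  refine (integrable_norm_iff (by fun_prop)).1 (h.congr (.of_forall fun x => ?_))
  simp

theorem integral_sq_gaussianReal : ∫ x, x ^ 2 ∂gaussianReal 0 1 = 1 := by
  have := variance_fun_id_gaussianReal (μ := 0) (v := 1)
  rw [variance_of_integral_eq_zero (by fun_prop) (by simp)] at this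
  simpa using this

/-- The fourth moment of the standard normal distribution. -/
theorem integral_pow_four_gaussianReal : ∫ x, x ^ 4 ∂gaussianReal 0 1 = 3 := by
  -- The fourth moment `M` is found by computing that of `N(0, 2)` twice: as the law of `√2 X` it is
  -- `4M`, as the law of `X + Y` it is `2M + 6`.
  have h1 : ∫ x, x ^ 4 ∂gaussianReal 0 2 = 4 * ∫ x, x ^ 4 ∂gaussianReal 0 1 := by
    have h := gaussianReal_map_const_mul (μ := 0) (v := 1) (√2)
    have e : NNReal.mk (√2 ^ 2) (sq_nonneg _) * 1 = (2 : NNReal) := by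
      ext; simp
    rw [e, mul_zero] at h
    rw [← h, integral_map (by fun_prop) (by fun_prop), ← integral_const_mul]
    congr 1 with x
    have : √2 ^ 4 = 4 := by
      rw [show √2 ^ 4 = (√2 ^ 2) ^ 2 by ring, Real.sq_sqrt (by norm_num)]; norm_num
    rw [mul_pow, this]
  have h2 : gaussianReal 0 1 ∗ gaussianReal 0 1 = gaussianReal 0 2 := by
    rw [gaussianReal_conv_gaussianReal]; norm_num
  have h3 : ∫ x, x ^ 4 ∂gaussianReal 0 2 = 2 * ∫ x, x ^ 4 ∂gaussianReal 0 1 + 6 := by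
    rw [← h2, integral_conv (by rw [h2]; exact integrable_pow_gaussianReal _ _ _)]
    set m := ∫ x, x ^ 4 ∂gaussianReal 0 1 with hm
    -- The third moment need not be evaluated: it only occurs multiplied by a mean, which is zero.
    set t := ∫ x, x ^ 3 ∂gaussianReal 0 1 with ht
    have I := fun n => integrable_pow_gaussianReal n 0 1
    have I1 : Integrable (fun x => x) (gaussianReal 0 1) := by simpa using I 1
    have mean (r : ℝ) : ∫ y, r * y ∂gaussianReal 0 1 = 0 := by
      rw [integral_const_mul, integral_id_gaussianReal, mul_zero]
    have inner (x : ℝ) : ∫ y, (x + y) ^ 4 ∂gaussianReal 0 1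
        = x ^ 4 + 6 * x ^ 2 + 4 * t * x + m := by
      have : ∀ y : ℝ, (x + y) ^ 4
          = x ^ 4 + 4 * x ^ 3 * y + 6 * x ^ 2 * y ^ 2 + 4 * x * y ^ 3 + y ^ 4 := fun y => by ring
      simp_rw [this]
      rw [integral_add _ (I 4), integral_add _ ((I 3).const_mul _),
        integral_add _ ((I 2).const_mul _), integral_add (integrable_const _) (I1.const_mul _)]
      · rw [mean]
        simp only [integral_const_mul, integral_sq_gaussianReal]
        simp [← hm, ← ht]
        ring
      · exact (integrable_const _).add (I1.const_mul _)
      · exact ((integrable_const _).add (I1.const_mul _)).add ((I 2).const_mul _)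
      · exact (((integrable_const _).add (I1.const_mul _)).add ((I 2).const_mul _)).add
          ((I 3).const_mul _)
    simp_rw [inner]
    rw [integral_add _ (integrable_const _), integral_add _ (I1.const_mul _),
      integral_add (I 4) ((I 2).const_mul _)]
    · rw [mean]
      simp only [integral_const_mul, integral_sq_gaussianReal]
      simp [← hm]
      ring
    · exact (I 4).add ((I 2).const_mul _)
    · exact ((I 4).add ((I 2).const_mul _)).add (I1.const_mul _)
  linarith

theorem memLp_two_sq_gaussianReal : MemLp (fun x : ℝ => x ^ 2) 2 (gaussianReal 0 1) := by
  rw [memLp_two_iff_integrable_sq (by fun_prop)]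
  simpa [← pow_mul] using integrable_pow_gaussianReal 4 0 1

theorem memLp_two_sum_sq (k : ℕ) :
    MemLp (fun x : Fin k → ℝ => ∑ i, x i ^ 2) 2 (Measure.pi fun _ => gaussianReal 0 1) :=
  memLp_finsetSum _ fun i _ => memLp_two_sq_gaussianReal.comp_measurePreserving
    (measurePreserving_eval (fun _ : Fin k => gaussianReal 0 1) i)

theorem memLp_two_chiSquareMeasure (k : ℕ) : MemLp (fun v : ℝ => v) 2 (chiSquareMeasure k) := by
  rw [chiSquareMeasure, memLp_map_measure_iff (by fun_prop) (Measurable.aemeasurable (by fun_prop))]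
  exact memLp_two_sum_sq k

theorem integral_chiSquareMeasure (k : ℕ) : ∫ v, v ∂chiSquareMeasure k = k := by
  rw [chiSquareMeasure, integral_map (Measurable.aemeasurable (by fun_prop)) (by fun_prop),
    integral_finsetSum]
  · have (i : Fin k) := integral_comp_eval (μ := fun _ : Fin k => gaussianReal 0 1) (i := i)
      (f := fun x : ℝ => x ^ 2) (by fun_prop)
    simp [this, integral_sq_gaussianReal]
  · exact fun i _ => integrable_comp_eval (μ := fun _ : Fin k => gaussianReal 0 1) (i := i)
      (integrable_pow_gaussianReal 2 0 1)

theorem integral_sq_chiSquareMeasure (k : ℕ) :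
    ∫ v, v ^ 2 ∂chiSquareMeasure k = k * (k + 2) := by
  have h1 : Var[fun v => v; chiSquareMeasure k] = 2 * k := by
    rw [chiSquareMeasure, variance_map (by fun_prop) (Measurable.aemeasurable (by fun_prop))]
    have h := variance_sum_pi (μ := fun _ : Fin k => gaussianReal 0 1)
      (X := fun _ x => x ^ 2) (fun _ => memLp_two_sq_gaussianReal)
    have e : (∑ i, fun ω : Fin k → ℝ => ω i ^ 2) = (fun v => v) ∘ fun x => ∑ i, x i ^ 2 := by
      ext x; simp
    rw [e] at h
    rw [h, variance_eq_sub memLp_two_sq_gaussianReal]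
    simp [integral_sq_gaussianReal, ← pow_mul, integral_pow_four_gaussianReal]
    ring
  rw [variance_eq_sub (memLp_two_chiSquareMeasure k), integral_chiSquareMeasure] at h1
  simp only [Pi.pow_apply] at h1
  linarith

/-! ### Gram determinants in adapted orthonormal bases. -/

section Basis

variable {E : Type*} [NormedAddCommGroup E] [InnerProductSpace ℝ E]

/-- An orthonormal basis adapted to the flag spanned by two successive families of vectors. -/
theorem exists_orthonormalBasis_adapted [FiniteDimensional ℝ E] {a k d : ℕ} (A : Fin a → E)
    (C : Fin k → E)
    (h : a + k + d = Module.finrank ℝ E) :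
    ∃ b : OrthonormalBasis ((Fin a ⊕ Fin k) ⊕ Fin d) ℝ E,
      (∀ i j, inner ℝ (A i) (b (.inl (.inr j))) = 0) ∧ (∀ i j, inner ℝ (A i) (b (.inr j)) = 0) ∧
      ∀ i j, inner ℝ (C i) (b (.inr j)) = 0 := by
  let e : (Fin a ⊕ Fin k) ⊕ Fin d ≃ Fin (a + k + d) :=
    (finSumFinEquiv.sumCongr (Equiv.refl _)).trans finSumFinEquiv
  -- Padding with zero vectors gives a family of length `finrank`. Gram–Schmidt completes it to a
  -- basis even when vectors are dependent, so no almost sure independence is ever needed.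
  let f : Fin (a + k + d) → E := fun i => Sum.elim (Sum.elim A C) 0 (e.symm i)
  have hcard : Module.finrank ℝ E = Fintype.card (Fin (a + k + d)) := by simp [h]
  let b₀ := InnerProductSpace.gramSchmidtOrthonormalBasis hcard f
  have key (s t) (hst : e s < e t) :
      inner ℝ (Sum.elim (Sum.elim A C) 0 s) (b₀.reindex e.symm t) = 0 := by
    have := InnerProductSpace.gramSchmidtOrthonormalBasis_inv_triangular hcard f hst
    rw [real_inner_comm]
    simpa [f, b₀] using this
  refine ⟨b₀.reindex e.symm, fun i j => key (.inl (.inl i)) (.inl (.inr j)) ?_,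
    fun i j => key (.inl (.inl i)) (.inr j) ?_, fun i j => key (.inl (.inr i)) (.inr j) ?_⟩ <;>
  · simp [e, Fin.lt_def]
    omega

theorem exists_orthonormalBasis_orthogonal [FiniteDimensional ℝ E] {ι : Type*} [Fintype ι] {d : ℕ} (x : ι → E)
    (h : Fintype.card ι + d = Module.finrank ℝ E) :
    ∃ b : OrthonormalBasis (ι ⊕ Fin d) ℝ E, ∀ i j, inner ℝ (x i) (b (.inr j)) = 0 := by
  let e := Fintype.equivFin ι
  obtain ⟨b, -, hb, -⟩ := exists_orthonormalBasis_adapted (fun i => x (e.symm i))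
    (Fin.elim0 : Fin 0 → E) h
  refine ⟨b.reindex (((Equiv.sumEmpty _ _).trans e.symm).sumCongr (Equiv.refl _)), fun i j => ?_⟩
  simpa using hb (e i) j

theorem gram_eq_mul_transpose {ι κ : Type*} [Fintype ι] [Fintype κ] {x : ι → E}
    (b : OrthonormalBasis (ι ⊕ κ) ℝ E) (hb : ∀ i j, inner ℝ (x i) (b (.inr j)) = 0) :
    Matrix.gram ℝ x = (Matrix.of fun i j => inner ℝ (x i) (b (.inl j))) *
      (Matrix.of fun i j => inner ℝ (x i) (b (.inl j))).transpose := by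
  ext i j
  simp only [Matrix.gram_apply, Matrix.mul_apply, Matrix.of_apply, Matrix.transpose_apply]
  rw [← b.sum_inner_mul_inner, Fintype.sum_sum_type]
  simp [hb, real_inner_comm]

/-- The coordinates beyond the first block vanish, so the coordinate matrix is square and its
determinant can be taken separately. -/
theorem det_gram_eq_sq {ι κ : Type*} [Fintype ι] [DecidableEq ι] [Fintype κ] {x : ι → E}
    (b : OrthonormalBasis (ι ⊕ κ) ℝ E) (hb : ∀ i j, inner ℝ (x i) (b (.inr j)) = 0) :
    (Matrix.gram ℝ x).det = (Matrix.of fun i j => inner ℝ (x i) (b (.inl j))).det ^ 2 := by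
  rw [gram_eq_mul_transpose b hb, Matrix.det_mul, Matrix.det_transpose, sq]

theorem det_gram_comp_equiv {ι κ : Type*} [Fintype ι] [DecidableEq ι] [Fintype κ] [DecidableEq κ]
    (e : κ ≃ ι) (x : ι → E) :
    (Matrix.gram ℝ fun k => x (e k)).det = (Matrix.gram ℝ x).det := by
  rw [← Matrix.det_submatrix_equiv_self e]
  rfl

/-- Adding a vector to a family multiplies the Gram determinant by the squared length of the
component of that vector orthogonal to the family. -/
theorem det_gram_sumElim_unit {ι κ : Type*} [Fintype ι] [DecidableEq ι] [Fintype κ] {x : ι → E}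
    (b : OrthonormalBasis (ι ⊕ κ) ℝ E) (hb : ∀ i j, inner ℝ (x i) (b (.inr j)) = 0) (y : E) :
    (Matrix.gram ℝ (Sum.elim x fun _ : Unit => y)).det =
      (Matrix.gram ℝ x).det * ∑ j, inner ℝ y (b (.inr j)) ^ 2 := by
  set T : Matrix ι ι ℝ := Matrix.of fun i j => inner ℝ (x i) (b (.inl j)) with hT
  set u : Matrix Unit ι ℝ := Matrix.of fun _ j => inner ℝ y (b (.inl j)) with hu
  set s := ∑ j, inner ℝ y (b (.inr j)) ^ 2 with hs
  -- Block LDLᵀ factorization: the middle factor carries `s`, the squared length of the part of `y`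
  -- along the `inr` basis vectors.
  have hg : Matrix.gram ℝ (Sum.elim x fun _ : Unit => y) =
      Matrix.fromBlocks T 0 u 1 * Matrix.fromBlocks 1 0 0 (Matrix.of fun _ _ => s) *
        Matrix.fromBlocks T.transpose u.transpose 0 1 := by
    rw [Matrix.fromBlocks_multiply, Matrix.fromBlocks_multiply]
    ext i j
    rw [Matrix.gram_apply, ← b.sum_inner_mul_inner, Fintype.sum_sum_type]
    rcases i with i | i <;> rcases j with j | j <;>
      simp [hb, hT, hu, hs, Matrix.mul_apply, real_inner_comm, sq]
  rw [hg, Matrix.det_mul, Matrix.det_mul, Matrix.det_fromBlocks_zero₁₂,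
    Matrix.det_fromBlocks_zero₁₂, Matrix.det_fromBlocks_zero₂₁, det_gram_eq_sq b hb]
  simp [← hT]
  ring

end Basis

/-! ### Gaussian vectors, Gram determinants and the conditional law of the minor. -/

section Gaussian

variable {E : Type*} [NormedAddCommGroup E] [InnerProductSpace ℝ E] [FiniteDimensional ℝ E]
  [MeasurableSpace E] [BorelSpace E]

/-- The coordinates of a standard Gaussian vector in an orthonormal basis are independent standard
normal random variables. -/
theorem measurePreserving_inner_stdGaussian {ι : Type*} [Fintype ι] (b : OrthonormalBasis ι ℝ E) :
    MeasurePreserving (fun y i => inner ℝ y (b i)) (stdGaussian E)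
      (Measure.pi fun _ => gaussianReal 0 1) where
  measurable := by fun_prop
  map_eq := by
    classical
    rw [stdGaussian_eq_map_pi_orthonormalBasis b, Measure.map_map (by fun_prop) (by fun_prop)]
    convert Measure.map_id
    ext x i
    simp [sum_inner, real_inner_smul_left, b.inner_eq_ite]

theorem measurable_det_gram {ι α : Type*} [Fintype ι] [DecidableEq ι] [MeasurableSpace α]
    {x : ι → α → E} (hx : ∀ i, Measurable (x i)) :
    Measurable fun a => (Matrix.gram ℝ fun i => x i a).det := by
  simp only [Matrix.det_apply, Matrix.gram_apply]
  fun_prop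

/-- The multiplier is the sum of squares of `d` coordinates of `y` in an orthonormal basis that
depends only on `x`; these are independent standard normals. -/
theorem map_det_gram_sumElim_unit {ι : Type*} [Fintype ι] [DecidableEq ι] {d : ℕ} (x : ι → E)
    (h : Fintype.card ι + d = Module.finrank ℝ E) :
    (stdGaussian E).map (fun y => (Matrix.gram ℝ (Sum.elim x fun _ : Unit => y)).det) =
      (chiSquareMeasure d).map fun v => (Matrix.gram ℝ x).det * v := by
  obtain ⟨b, hb⟩ := exists_orthonormalBasis_orthogonal x h
  simp_rw [det_gram_sumElim_unit b hb]
  have hm := (measurePreserving_pi_comp_injective (fun _ : ι ⊕ Fin d => gaussianReal 0 1)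
    (e := (.inr : Fin d → ι ⊕ Fin d)) Sum.inr_injective).comp
    (measurePreserving_inner_stdGaussian b)
  rw [chiSquareMeasure, ← hm.map_eq, Measure.map_map (by fun_prop) (by fun_prop),
    Measure.map_map (by fun_prop) (by fun_prop)]
  rfl

theorem measurePreserving_pi_init_last {X : Type*} [MeasurableSpace X] {k : ℕ}
    (μ : Fin (k + 1) → Measure X) [∀ i, SigmaFinite (μ i)] :
    MeasurePreserving (fun x : Fin (k + 1) → X => (fun i : Fin k => x i.castSucc, x (.last k)))
      (Measure.pi μ) ((Measure.pi fun i : Fin k => μ i.castSucc).prod (μ (.last k))) := by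
  have h := (Measure.measurePreserving_swap).comp (measurePreserving_piFinSuccAbove μ (.last k))
  simp only [Fin.succAbove_last] at h
  have hfun : (fun x : Fin (k + 1) → X => (fun i : Fin k => x i.castSucc, x (.last k))) =
      Prod.swap ∘ MeasurableEquiv.piFinSuccAbove (fun _ => X) (.last k) := by
    funext x
    refine Prod.ext (funext fun i => ?_) ?_
    · simp [MeasurableEquiv.piFinSuccAbove, Fin.init]
    · simp [MeasurableEquiv.piFinSuccAbove]
  rw [hfun]
  exact h

/-- The law of the Gram determinant of a fixed family, enlarged by independent standard Gaussian
vectors. -/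
theorem map_det_gram_sumElim {ι : Type*} [Fintype ι] [DecidableEq ι] {k : ℕ} (A : ι → E)
    (h : Fintype.card ι + k ≤ Module.finrank ℝ E) :
    (Measure.pi fun _ : Fin k => stdGaussian E).map
        (fun C => (Matrix.gram ℝ (Sum.elim A C)).det) =
      (Measure.pi fun i : Fin k => chiSquareMeasure (Module.finrank ℝ E - (Fintype.card ι + i))).map
        fun v => (Matrix.gram ℝ A).det * ∏ i, v i := by
  induction k with
  | zero =>
    have (C : Fin 0 → E) : (Matrix.gram ℝ (Sum.elim A C)).det = (Matrix.gram ℝ A).det := by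
      rw [← det_gram_comp_equiv (Equiv.sumEmpty ι (Fin 0)).symm]
      rfl
    simp [this]
  | succ k ih =>
    have hG : Measurable fun C : Fin k → E => (Matrix.gram ℝ (Sum.elim A C)).det := by
      have := measurable_det_gram (α := Fin k → E) (x := fun i C => Sum.elim A C i)
        (by rintro (i | i) <;> simp <;> fun_prop)
      exact this
    have hG' : Measurable fun p : (Fin k → E) × E =>
        (Matrix.gram ℝ (Sum.elim (Sum.elim A p.1) fun _ : Unit => p.2)).det := by
      have := measurable_det_gram (α := (Fin k → E) × E)
        (x := fun i p => Sum.elim (Sum.elim A p.1) (fun _ : Unit => p.2) i)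
        (by rintro ((i | i) | i) <;> simp <;> fun_prop)
      exact this
    have hdet (C : Fin (k + 1) → E) : (Matrix.gram ℝ (Sum.elim A C)).det =
        (Matrix.gram ℝ (Sum.elim (Sum.elim A fun i : Fin k => C i.castSucc)
          fun _ : Unit => C (.last k))).det := by
      let e : (ι ⊕ Fin k) ⊕ Unit ≃ ι ⊕ Fin (k + 1) :=
        (Equiv.sumAssoc _ _ _).trans ((Equiv.refl ι).sumCongr
          (((Equiv.refl _).sumCongr (Equiv.ofUnique Unit (Fin 1))).trans finSumFinEquiv))
      rw [← det_gram_comp_equiv e]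
      congr 2
      funext i
      rcases i with (i | i) | i <;> simp [e] <;> rfl
    have hl := measurePreserving_pi_init_last fun _ : Fin (k + 1) => stdGaussian E
    have hr := measurePreserving_pi_init_last fun i : Fin (k + 1) =>
      chiSquareMeasure (Module.finrank ℝ E - (Fintype.card ι + i))
    simp_rw [hdet]
    have e1 : (Measure.pi fun _ : Fin (k + 1) => stdGaussian E).map (fun C =>
        (Matrix.gram ℝ (Sum.elim (Sum.elim A fun i : Fin k => C i.castSucc)
          fun _ : Unit => C (.last k))).det) =
        ((Measure.pi fun _ : Fin k => stdGaussian E).prod (stdGaussian E)).map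
          fun p => (Matrix.gram ℝ (Sum.elim (Sum.elim A p.1) fun _ : Unit => p.2)).det := by
      rw [← hl.map_eq, Measure.map_map hG' hl.measurable]
      rfl
    have hmul : Measurable fun p : ℝ × ℝ => p.1 * p.2 := by fun_prop
    rw [e1, map_prod_eq_of_forall_map_eq _ _
      (chiSquareMeasure (Module.finrank ℝ E - (Fintype.card ι + k))) hG'
      (f' := fun p => (Matrix.gram ℝ (Sum.elim A p.1)).det * p.2)
      ((hG.comp measurable_fst).mul measurable_snd)
      -- Conditionally on the earlier vectors, the law of the new factor does not depend on them;
      -- this is what makes the factors independent.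
      (fun C => map_det_gram_sumElim_unit (Sum.elim A C)
        (by rw [Fintype.card_sum, Fintype.card_fin]; omega))]
    have e2 : (fun p : (Fin k → E) × ℝ => (Matrix.gram ℝ (Sum.elim A p.1)).det * p.2) =
        (fun p : ℝ × ℝ => p.1 * p.2) ∘
          Prod.map (fun C : Fin k → E => (Matrix.gram ℝ (Sum.elim A C)).det) id := rfl
    rw [e2, ← Measure.map_map hmul (by fun_prop), ← Measure.map_prod_map _ _ hG measurable_id,
      ih (by omega), Measure.map_prod_map _ _ (by fun_prop) measurable_id,
      Measure.map_map hmul (by fun_prop)]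
    simp only [Fin.val_last, Fin.val_castSucc] at hr
    rw [← hr.map_eq, Measure.map_map (by fun_prop) hr.measurable]
    congr 1
    funext v
    simp [Fin.prod_univ_castSucc, mul_assoc]

theorem measurable_det_of {ι : Type*} [Fintype ι] [DecidableEq ι] :
    Measurable fun Z : ι → ι → ℝ => (Matrix.of Z).det := by
  simp only [Matrix.det_apply, Matrix.of_apply]
  fun_prop

/-- The determinant of a nonempty Gaussian matrix has a symmetric law. -/
theorem map_neg_det_gaussian {k : ℕ} (hk : k ≠ 0) :
    (Measure.pi fun _ : Fin k => Measure.pi fun _ : Fin k => gaussianReal 0 1).map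
        (fun Z => -(Matrix.of Z).det) =
      (Measure.pi fun _ : Fin k => Measure.pi fun _ : Fin k => gaussianReal 0 1).map
        fun Z => (Matrix.of Z).det := by
  have : NeZero k := ⟨hk⟩
  have hneg : MeasurePreserving (fun x : ℝ => -x) (gaussianReal 0 1) (gaussianReal 0 1) :=
    ⟨by fun_prop, by simp [gaussianReal_map_neg]⟩
  -- Negating row `0` preserves the Gaussian law and flips the sign of the determinant.
  have hrow (i : Fin k) : MeasurePreserving
      (fun (z : Fin k → ℝ) j => if i = 0 then -z j else z j)
      (Measure.pi fun _ => gaussianReal 0 1) (Measure.pi fun _ => gaussianReal 0 1) := by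
    split_ifs
    · exact measurePreserving_pi_map fun _ => hneg
    · exact .id _
  have hm := measurePreserving_pi_map hrow
  conv_rhs => rw [← hm.map_eq, Measure.map_map measurable_det_of hm.measurable]
  congr 1
  funext Z
  have hZ : (Matrix.of fun i j => if i = 0 then -Z i j else Z i j) =
      (Matrix.of Z).updateRow 0 ((-1 : ℝ) • (Matrix.of Z) 0) := by
    ext i j
    by_cases h : i = 0 <;> simp [h]
  rw [Function.comp_apply, hZ, Matrix.det_updateRow_smul, Matrix.updateRow_eq_self, neg_one_mul]

/-- Symmetry of the law absorbs the sign of `s`, except for `k = 0`, where the determinant is the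
constant `1`. -/
theorem map_mul_det_gaussian {k : ℕ} (s : ℝ) (hs : k = 0 → 0 ≤ s) :
    (Measure.pi fun _ : Fin k => Measure.pi fun _ : Fin k => gaussianReal 0 1).map
        (fun Z => s * (Matrix.of Z).det) =
      (Measure.pi fun _ : Fin k => Measure.pi fun _ : Fin k => gaussianReal 0 1).map
        fun Z => |s| * (Matrix.of Z).det := by
  rcases le_total 0 s with h | h
  · rw [abs_of_nonneg h]
  rcases eq_or_ne k 0 with hk | hk
  · rw [abs_of_nonneg (hs hk)]
  have hm : Measurable fun x : ℝ => s * x := by fun_prop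
  have := congrArg (Measure.map fun x => s * x) (map_neg_det_gaussian hk)
  rw [Measure.map_map hm (by exact measurable_det_of.neg), Measure.map_map hm measurable_det_of] at this
  simp only [abs_of_nonpos h, neg_mul, ← mul_neg]
  exact this.symm

/-- For fixed vectors `A` and `C`, and independent standard Gaussian vectors `B`, the law of the
determinant of the matrix of inner products of `(A, B)` with `(A, C)`. -/
theorem map_det_cross_gram {a k : ℕ} (A : Fin a → E) (C : Fin k → E)
    (h : a + k ≤ Module.finrank ℝ E) (ε : ℝ) (hε : |ε| = 1) (hk : k = 0 → ε = 1) :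
    (Measure.pi fun _ : Fin k => stdGaussian E).map (fun B =>
        ε * (Matrix.of fun i j => inner ℝ (Sum.elim A B i) (Sum.elim A C j)).det) =
      (Measure.pi fun _ : Fin k => Measure.pi fun _ : Fin k => gaussianReal 0 1).map fun Z =>
        √((Matrix.gram ℝ A).det * (Matrix.gram ℝ (Sum.elim A C)).det) * (Matrix.of Z).det := by
  obtain ⟨d, hd⟩ := Nat.exists_eq_add_of_le h
  obtain ⟨b, hA, hA', hC⟩ := exists_orthonormalBasis_adapted A C hd.symm
  have hAC : ∀ i j, inner ℝ (Sum.elim A C i) (b (.inr j)) = 0 := by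
    rintro (i | i) j
    exacts [hA' i j, hC i j]
  set T₁ : Matrix (Fin a) (Fin a) ℝ := Matrix.of fun i j => inner ℝ (A i) (b (.inl (.inl j)))
    with hT₁
  set T : Matrix (Fin a ⊕ Fin k) (Fin a ⊕ Fin k) ℝ :=
    Matrix.of fun i j => inner ℝ (Sum.elim A C i) (b (.inl j)) with hT
  have hgA : (Matrix.gram ℝ A).det = T₁.det ^ 2 := by
    have := det_gram_eq_sq (x := A) (b.reindex (Equiv.sumAssoc _ _ _)) fun i j => by
      rcases j with j | j <;> simp [hA, hA']
    simpa using this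
  have hgAC : (Matrix.gram ℝ (Sum.elim A C)).det = T.det ^ 2 := det_gram_eq_sq b hAC
  have hTblock : T = Matrix.fromBlocks T₁ 0
      (Matrix.of fun i j => inner ℝ (C i) (b (.inl (.inl j))))
      (Matrix.of fun i j => inner ℝ (C i) (b (.inl (.inr j)))) := by
    ext (i | i) (j | j) <;> simp [hT, hT₁, hA]
  have hdet (B : Fin k → E) :
      ε * (Matrix.of fun i j => inner ℝ (Sum.elim A B i) (Sum.elim A C j)).det =
        (ε * T₁.det * T.det) * (Matrix.of fun i j => inner ℝ (B i) (b (.inl (.inr j)))).det := by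
    -- Parseval in `b`: the last `d` coordinates of `(A, C)` vanish, so those of `B` do not
    -- contribute; the zero block says that `A` has no middle coordinates.
    have hM : (Matrix.of fun i j => inner ℝ (Sum.elim A B i) (Sum.elim A C j)) =
        Matrix.fromBlocks T₁ 0 (Matrix.of fun i j => inner ℝ (B i) (b (.inl (.inl j))))
          (Matrix.of fun i j => inner ℝ (B i) (b (.inl (.inr j)))) * T.transpose := by
      ext i j
      rw [Matrix.of_apply, ← b.sum_inner_mul_inner, Fintype.sum_sum_type, Matrix.mul_apply,
        Finset.sum_eq_zero (s := (Finset.univ : Finset (Fin d)))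
          (fun l _ => by rw [real_inner_comm (Sum.elim A C j), hAC, mul_zero]), add_zero]
      refine Finset.sum_congr rfl fun l _ => ?_
      rw [real_inner_comm (Sum.elim A C j)]
      rcases i with i | i <;> rcases l with l | l <;> simp [hT, hT₁, hA]
    rw [hM, Matrix.det_mul, Matrix.det_transpose, Matrix.det_fromBlocks_zero₁₂]
    ring
  have hm : MeasurePreserving (fun (B : Fin k → E) i j => inner ℝ (B i) (b (.inl (.inr j))))
      (Measure.pi fun _ => stdGaussian E)
      (Measure.pi fun _ => Measure.pi fun _ => gaussianReal 0 1) :=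
    measurePreserving_pi_map fun _ =>
      (measurePreserving_pi_comp_injective (fun _ => gaussianReal 0 1)
        (e := fun j : Fin k => (.inl (.inr j) : (Fin a ⊕ Fin k) ⊕ Fin d))
        (fun _ _ h => by simpa using h)).comp (measurePreserving_inner_stdGaussian b)
  have hs : √((Matrix.gram ℝ A).det * (Matrix.gram ℝ (Sum.elim A C)).det) =
      |ε * T₁.det * T.det| := by
    rw [hgA, hgAC, ← mul_pow, Real.sqrt_sq_eq_abs, mul_assoc, abs_mul ε, hε, one_mul]
  -- For `k = 0` the matrix `T` reduces to `T₁`, so the factor is the square of `T₁.det`.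
  have hpos : k = 0 → 0 ≤ ε * T₁.det * T.det := by
    intro h0
    subst h0
    rw [hk rfl, hTblock, Matrix.det_fromBlocks_zero₁₂]
    simp [mul_self_nonneg]
  have hmeas : Measurable fun Z : Fin k → Fin k → ℝ => (ε * T₁.det * T.det) * (Matrix.of Z).det :=
    measurable_det_of.const_mul _
  simp_rw [hdet, hs]
  rw [← map_mul_det_gaussian _ hpos, ← hm.map_eq, Measure.map_map hmeas hm.measurable]
  rfl

end Gaussian

/-! ### Unconditional law of the minor of a Gaussian Gram matrix. -/

section GaussianMinor

theorem ae_pi_nonneg_chiSquareMeasure {ι : Type*} [Fintype ι] (d : ι → ℕ) :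
    ∀ᵐ v ∂Measure.pi fun i => chiSquareMeasure (d i), ∀ i, 0 ≤ v i :=
  ae_all_iff.2 fun i => (measurePreserving_eval (fun i => chiSquareMeasure (d i)) i
    ).quasiMeasurePreserving.ae (ae_nonneg_chiSquareMeasure (d i))

theorem ae_prod_nonneg_chiSquareMeasure {ι κ α : Type*} [Fintype ι] [Fintype κ]
    [MeasurableSpace α] (d : ι → ℕ) (d' : κ → ℕ) (ρ : Measure α) [IsProbabilityMeasure ρ] :
    ∀ᵐ p ∂((Measure.pi fun i => chiSquareMeasure (d i)).prod
        (Measure.pi fun i => chiSquareMeasure (d' i))).prod ρ,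
      (∀ i, 0 ≤ p.1.1 i) ∧ ∀ i, 0 ≤ p.1.2 i :=
  Measure.quasiMeasurePreserving_fst.ae
    ((Measure.quasiMeasurePreserving_fst.ae (ae_pi_nonneg_chiSquareMeasure d)).and
      (Measure.quasiMeasurePreserving_snd.ae (ae_pi_nonneg_chiSquareMeasure d')))

theorem measurable_chiSquare_mul_det {ι κ : Type*} [Fintype ι] [Fintype κ] [DecidableEq κ] :
    Measurable fun p : ((ι → ℝ) × (κ → ℝ)) × (κ → κ → ℝ) =>
      ((∏ i, p.1.1 i) * ∏ i, √(p.1.2 i)) * (Matrix.of p.2).det :=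
  Measurable.mul (by fun_prop) (measurable_det_of.comp measurable_snd)

variable {E : Type*} [NormedAddCommGroup E] [InnerProductSpace ℝ E] [FiniteDimensional ℝ E]
  [MeasurableSpace E] [BorelSpace E]

theorem map_det_gram {k : ℕ} (h : k ≤ Module.finrank ℝ E) :
    (Measure.pi fun _ : Fin k => stdGaussian E).map (fun C => (Matrix.gram ℝ C).det) =
      (Measure.pi fun i : Fin k => chiSquareMeasure (Module.finrank ℝ E - i)).map
        fun v => ∏ i, v i := by
  have := map_det_gram_sumElim (k := k) (Empty.elim : Empty → E) (by simpa using h)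
  have e (C : Fin k → E) : (Matrix.gram ℝ (Sum.elim Empty.elim C)).det
      = (Matrix.gram ℝ C).det := by
    rw [← det_gram_comp_equiv (Equiv.emptySum Empty (Fin k)).symm]
    rfl
  simpa [e] using this

/-- The joint law is needed: both determinants appear under one square root, and they share the
chi-square factors of `A`. -/
theorem map_prod_det_gram {a k : ℕ} (h : a + k ≤ Module.finrank ℝ E) :
    ((Measure.pi fun _ : Fin a => stdGaussian E).prod
        (Measure.pi fun _ : Fin k => stdGaussian E)).map
        (fun p => ((Matrix.gram ℝ p.1).det, (Matrix.gram ℝ (Sum.elim p.1 p.2)).det)) =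
      ((Measure.pi fun i : Fin a => chiSquareMeasure (Module.finrank ℝ E - i)).prod
        (Measure.pi fun i : Fin k => chiSquareMeasure (Module.finrank ℝ E - (a + i)))).map
        fun p => (∏ i, p.1 i, (∏ i, p.1 i) * ∏ i, p.2 i) := by
  have hA : Measurable fun A : Fin a → E => (Matrix.gram ℝ A).det :=
    measurable_det_gram fun i => measurable_pi_apply i
  have hAC : Measurable fun p : (Fin a → E) × (Fin k → E) =>
      (Matrix.gram ℝ (Sum.elim p.1 p.2)).det := by
    have := measurable_det_gram (α := (Fin a → E) × (Fin k → E))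
      (x := fun i p => Sum.elim p.1 p.2 i) (by rintro (i | i) <;> simp <;> fun_prop)
    exact this
  have hg : Measurable fun q : ℝ × (Fin k → ℝ) => (q.1, q.1 * ∏ i, q.2 i) := by fun_prop
  rw [map_prod_eq_of_forall_map_eq _ _
    (Measure.pi fun i : Fin k => chiSquareMeasure (Module.finrank ℝ E - (a + i)))
    (f' := (fun q : ℝ × (Fin k → ℝ) => (q.1, q.1 * ∏ i, q.2 i)) ∘
      Prod.map (fun A : Fin a → E => (Matrix.gram ℝ A).det) id)
    (by exact (hA.comp measurable_fst).prodMk hAC) (hg.comp (by fun_prop))]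
  · rw [← Measure.map_map hg (by fun_prop), ← Measure.map_prod_map _ _ hA measurable_id,
      map_det_gram (by omega), Measure.map_prod_map _ _ (by fun_prop) measurable_id,
      Measure.map_map hg (by fun_prop)]
    rfl
  · intro A
    have h1 := map_det_gram_sumElim (k := k) A (by simpa using h)
    have hp : Measurable fun t : ℝ => ((Matrix.gram ℝ A).det, t) := by fun_prop
    have h2 := congrArg (Measure.map fun t => ((Matrix.gram ℝ A).det, t)) h1
    rw [Measure.map_map hp (by exact hAC.comp measurable_prodMk_left),
      Measure.map_map hp (by fun_prop)]
      at h2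
    simpa [Function.comp_def] using h2

theorem measurable_det_cross_gram {a k : ℕ} (ε : ℝ) :
    Measurable fun p : ((Fin a → E) × (Fin k → E)) × (Fin k → E) =>
      ε * (Matrix.of fun i j =>
        inner ℝ (Sum.elim p.1.1 p.2 i) (Sum.elim p.1.1 p.1.2 j)).det := by
  have h1 (i) : Measurable fun p : ((Fin a → E) × (Fin k → E)) × (Fin k → E) =>
    Sum.elim p.1.1 p.2 i := by rcases i with i | i <;> simp <;> fun_prop
  have h2 (i) : Measurable fun p : ((Fin a → E) × (Fin k → E)) × (Fin k → E) =>
    Sum.elim p.1.1 p.1.2 i := by rcases i with i | i <;> simp <;> fun_prop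
  simp only [Matrix.det_apply, Matrix.of_apply]
  fun_prop

/-- The law of a minor of a Gram matrix of independent standard Gaussian vectors, in terms of the
rows `A` common to both index sets and the remaining rows `B` and `C`. -/
theorem map_det_cross_gram_prod {a k : ℕ} (h : a + k ≤ Module.finrank ℝ E) (ε : ℝ) (hε : |ε| = 1)
    (hk : k = 0 → ε = 1) :
    (((Measure.pi fun _ : Fin a => stdGaussian E).prod
        (Measure.pi fun _ : Fin k => stdGaussian E)).prod
        (Measure.pi fun _ : Fin k => stdGaussian E)).map
        (fun p => ε * (Matrix.of fun i j =>
          inner ℝ (Sum.elim p.1.1 p.2 i) (Sum.elim p.1.1 p.1.2 j)).det) =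
      (((Measure.pi fun i : Fin a => chiSquareMeasure (Module.finrank ℝ E - i)).prod
        (Measure.pi fun i : Fin k => chiSquareMeasure (Module.finrank ℝ E - (a + i)))).prod
        (Measure.pi fun _ : Fin k => Measure.pi fun _ : Fin k => gaussianReal 0 1)).map
        fun p => ((∏ i, p.1.1 i) * ∏ i, √(p.1.2 i)) * (Matrix.of p.2).det := by
  have hA : Measurable fun A : Fin a → E => (Matrix.gram ℝ A).det :=
    measurable_det_gram fun i => measurable_pi_apply i
  have hAC : Measurable fun p : (Fin a → E) × (Fin k → E) =>
      (Matrix.gram ℝ (Sum.elim p.1 p.2)).det := by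
    have := measurable_det_gram (α := (Fin a → E) × (Fin k → E))
      (x := fun i p => Sum.elim p.1 p.2 i) (by rintro (i | i) <;> simp <;> fun_prop)
    exact this
  have hg : Measurable fun q : (ℝ × ℝ) × (Fin k → Fin k → ℝ) =>
      √(q.1.1 * q.1.2) * (Matrix.of q.2).det :=
    Measurable.mul (by fun_prop) (measurable_det_of.comp measurable_snd)
  have hpair : Measurable fun p : (Fin a → E) × (Fin k → E) =>
      ((Matrix.gram ℝ p.1).det, (Matrix.gram ℝ (Sum.elim p.1 p.2)).det) :=
    (hA.comp measurable_fst).prodMk hAC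
  have hpair' : Measurable fun p : (Fin a → ℝ) × (Fin k → ℝ) =>
    (∏ i, p.1 i, (∏ i, p.1 i) * ∏ i, p.2 i) := by fun_prop
  rw [map_prod_eq_of_forall_map_eq _ _
    (Measure.pi fun _ : Fin k => Measure.pi fun _ : Fin k => gaussianReal 0 1)
    (f' := (fun q : (ℝ × ℝ) × (Fin k → Fin k → ℝ) => √(q.1.1 * q.1.2) * (Matrix.of q.2).det) ∘
      Prod.map (fun p : (Fin a → E) × (Fin k → E) =>
        ((Matrix.gram ℝ p.1).det, (Matrix.gram ℝ (Sum.elim p.1 p.2)).det)) id)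
    (measurable_det_cross_gram ε) (hg.comp (hpair.prodMap measurable_id))
    (fun p => map_det_cross_gram p.1 p.2 h ε hε hk),
    ← Measure.map_map hg (hpair.prodMap measurable_id),
    ← Measure.map_prod_map _ _ hpair measurable_id, map_prod_det_gram h,
    Measure.map_prod_map _ _ hpair' measurable_id,
    Measure.map_map hg (hpair'.prodMap measurable_id)]
  -- The identity `√(P · (P · Q)) = P √Q`, with `√Q` split into factors, needs nonnegative
  -- chi-square values, hence holds only almost everywhere.
  refine Measure.map_congr ?_
  filter_upwards [ae_prod_nonneg_chiSquareMeasure (fun i : Fin a => Module.finrank ℝ E - i)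
    (fun i : Fin k => Module.finrank ℝ E - (a + i))
    (Measure.pi fun _ : Fin k => Measure.pi fun _ : Fin k => gaussianReal 0 1)] with p hp
  simp only [Function.comp_apply, Prod.map_fst, Prod.map_snd, id]
  rw [← mul_assoc, Real.sqrt_mul (mul_self_nonneg _),
    Real.sqrt_mul_self (Finset.prod_nonneg fun i _ => hp.1 i), Real.sqrt_prod _ fun i _ => hp.2 i]

end GaussianMinor

/-! ### Moments of the chi-square and Gaussian determinant product. -/

section Moments

theorem measurePreserving_rows (ι κ : Type*) [Fintype ι] [Fintype κ] :
    MeasurePreserving (fun (Z : ι → κ → ℝ) i => WithLp.toLp 2 (Z i))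
      (Measure.pi fun _ => Measure.pi fun _ => gaussianReal 0 1)
      (Measure.pi fun _ => stdGaussian (EuclideanSpace ℝ κ)) :=
  measurePreserving_pi_map fun _ => ⟨by fun_prop, map_pi_eq_stdGaussian⟩

theorem prod_natCast_sub (N k : ℕ) (h : k ≤ N) :
    ∏ i : Fin k, ((N - i : ℕ) : ℝ) = (N ! : ℝ) / ((N - k)! : ℝ) := by
  rw [Fin.prod_univ_eq_prod_range (fun i => ((N - i : ℕ) : ℝ)), ← Nat.cast_prod,
    ← Nat.descFactorial_eq_prod_range, eq_div_iff (by positivity), mul_comm]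
  exact_mod_cast Nat.factorial_mul_descFactorial h

theorem integrable_chiSquareMeasure (d : ℕ) : Integrable (fun v => v) (chiSquareMeasure d) :=
  (memLp_two_chiSquareMeasure d).integrable (by norm_num)

/-- `det Z² = det (Z Zᵀ)` is the Gram determinant of the `k` rows, Gaussian vectors in dimension
`k`. -/
theorem map_sq_det_gaussian (k : ℕ) :
    (Measure.pi fun _ : Fin k => Measure.pi fun _ : Fin k => gaussianReal 0 1).map
        (fun Z => (Matrix.of Z).det ^ 2) =
      (Measure.pi fun i : Fin k => chiSquareMeasure (k - i)).map fun v => ∏ i, v i := by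
  have h := map_det_gram (E := EuclideanSpace ℝ (Fin k)) (k := k) (by simp)
  have hr := measurePreserving_rows (Fin k) (Fin k)
  rw [← hr.map_eq, Measure.map_map (measurable_det_gram fun i => measurable_pi_apply i)
    hr.measurable] at h
  simp only [finrank_euclideanSpace, Fintype.card_fin] at h
  rw [← h]
  congr 1
  funext Z
  rw [sq]
  nth_rewrite 2 [← Matrix.det_transpose]
  rw [← Matrix.det_mul, Function.comp_apply]
  congr 1
  ext i j
  simp [Matrix.mul_apply, Matrix.gram_apply, PiLp.inner_apply, mul_comm]

theorem integrable_sq_det_gaussian (k : ℕ) :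
    Integrable (fun Z : Fin k → Fin k → ℝ => (Matrix.of Z).det ^ 2)
      (Measure.pi fun _ => Measure.pi fun _ => gaussianReal 0 1) := by
  have h : Integrable (fun x : ℝ => x)
      ((Measure.pi fun i : Fin k => chiSquareMeasure (k - i)).map fun v => ∏ i, v i) := by
    rw [integrable_map_measure (by fun_prop) (by fun_prop)]
    exact Integrable.fintype_prod_dep fun i => integrable_chiSquareMeasure _
  rw [← map_sq_det_gaussian] at h
  exact h.comp_measurable (measurable_det_of.pow_const 2)

theorem integral_sq_det_gaussian (k : ℕ) :
    ∫ Z : Fin k → Fin k → ℝ, (Matrix.of Z).det ^ 2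
      ∂(Measure.pi fun _ => Measure.pi fun _ => gaussianReal 0 1) = k ! := by
  have h : ∫ x, x ∂((Measure.pi fun i : Fin k => chiSquareMeasure (k - i)).map
      fun v => ∏ i, v i) = k ! := by
    rw [integral_map (by fun_prop) (by fun_prop),
      integral_fintype_prod_eq_prod (fun _ x => x)]
    simp_rw [integral_chiSquareMeasure]
    rw [prod_natCast_sub k k le_rfl, Nat.sub_self, Nat.factorial_zero, Nat.cast_one, div_one]
  rw [← map_sq_det_gaussian, integral_map (measurable_det_of.pow_const 2).aemeasurable
    (by fun_prop)] at h
  exact h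

theorem integral_det_gaussian {k : ℕ} (hk : k ≠ 0) :
    ∫ Z : Fin k → Fin k → ℝ, (Matrix.of Z).det
      ∂(Measure.pi fun _ => Measure.pi fun _ => gaussianReal 0 1) = 0 := by
  have h := congrArg (fun μ => ∫ x, x ∂μ) (map_neg_det_gaussian hk)
  simp only at h
  rw [integral_map (by exact measurable_det_of.neg.aemeasurable) (by fun_prop),
    integral_map measurable_det_of.aemeasurable (by fun_prop), integral_neg] at h
  linarith

variable (n a k : ℕ)

theorem ae_sq_chiSquare_mul_det :
    (fun p : ((Fin a → ℝ) × (Fin k → ℝ)) × (Fin k → Fin k → ℝ) =>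
      (((∏ i, p.1.1 i) * ∏ i, √(p.1.2 i)) * (Matrix.of p.2).det) ^ 2) =ᵐ[
        ((Measure.pi fun i : Fin a => chiSquareMeasure (n - i)).prod
        (Measure.pi fun i : Fin k => chiSquareMeasure (n - (a + i)))).prod
        (Measure.pi fun _ : Fin k => Measure.pi fun _ : Fin k => gaussianReal 0 1)]
      fun p => ((∏ i, p.1.1 i ^ 2) * ∏ i, p.1.2 i) * (Matrix.of p.2).det ^ 2 := by
  filter_upwards [ae_prod_nonneg_chiSquareMeasure (fun i : Fin a => n - i)
    (fun i : Fin k => n - (a + i))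
    (Measure.pi fun _ : Fin k => Measure.pi fun _ : Fin k => gaussianReal 0 1)] with p hp
  rw [mul_pow, mul_pow, ← Finset.prod_pow, ← Finset.prod_pow]
  congr 2
  exact Finset.prod_congr rfl fun i _ => Real.sq_sqrt (hp.2 i)

theorem memLp_two_chiSquare_mul_det :
    MemLp (fun p : ((Fin a → ℝ) × (Fin k → ℝ)) × (Fin k → Fin k → ℝ) =>
      ((∏ i, p.1.1 i) * ∏ i, √(p.1.2 i)) * (Matrix.of p.2).det) 2
        (((Measure.pi fun i : Fin a => chiSquareMeasure (n - i)).prod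
        (Measure.pi fun i : Fin k => chiSquareMeasure (n - (a + i)))).prod
        (Measure.pi fun _ : Fin k => Measure.pi fun _ : Fin k => gaussianReal 0 1)) := by
  rw [memLp_two_iff_integrable_sq measurable_chiSquare_mul_det.aestronglyMeasurable]
  refine Integrable.congr ?_ (ae_sq_chiSquare_mul_det n a k).symm
  refine Integrable.mul_prod
    (f := fun q : (Fin a → ℝ) × (Fin k → ℝ) => (∏ i, q.1 i ^ 2) * ∏ i, q.2 i)
    (Integrable.mul_prod (f := fun u : Fin a → ℝ => ∏ i, u i ^ 2)
      (g := fun v : Fin k → ℝ => ∏ i, v i) ?_ ?_) (integrable_sq_det_gaussian k)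
  · exact Integrable.fintype_prod_dep (f := fun (_ : Fin a) (x : ℝ) => x ^ 2) fun i =>
      (memLp_two_chiSquareMeasure _).integrable_sq
  · exact Integrable.fintype_prod_dep fun i => integrable_chiSquareMeasure _

theorem integral_sq_chiSquare_mul_det (h : a + k ≤ n) :
    ∫ p : ((Fin a → ℝ) × (Fin k → ℝ)) × (Fin k → Fin k → ℝ),
      (((∏ i, p.1.1 i) * ∏ i, √(p.1.2 i)) * (Matrix.of p.2).det) ^ 2
        ∂(((Measure.pi fun i : Fin a => chiSquareMeasure (n - i)).prod
        (Measure.pi fun i : Fin k => chiSquareMeasure (n - (a + i)))).prod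
        (Measure.pi fun _ : Fin k => Measure.pi fun _ : Fin k => gaussianReal 0 1)) =
      (n ! : ℝ) / ((n - (a + k))! : ℝ) * (((n + 2)! : ℝ) / ((n + 2 - a)! : ℝ)) * (k ! : ℝ) := by
  rw [integral_congr_ae (ae_sq_chiSquare_mul_det n a k),
    integral_prod_mul (fun q : (Fin a → ℝ) × (Fin k → ℝ) => (∏ i, q.1 i ^ 2) * ∏ i, q.2 i)
      (fun Z : Fin k → Fin k → ℝ => (Matrix.of Z).det ^ 2),
    integral_prod_mul (fun u : Fin a → ℝ => ∏ i, u i ^ 2) (fun v : Fin k → ℝ => ∏ i, v i),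
    integral_sq_det_gaussian, integral_fintype_prod_eq_prod (fun _ x => x ^ 2),
    integral_fintype_prod_eq_prod (fun _ x => x)]
  simp_rw [integral_chiSquareMeasure, integral_sq_chiSquareMeasure]
  -- The second moments `(n - i)(n - i + 2)` split into two falling factorials: the factors `n - i`
  -- join those of the second group to run over all `a + k` indices, and the factors `n + 2 - i`
  -- start from `n + 2`.
  rw [Finset.prod_mul_distrib, ← prod_natCast_sub n (a + k) h,
    ← prod_natCast_sub (n + 2) a (by omega), Fin.prod_univ_add]
  have (i : Fin a) : ((n - i : ℕ) : ℝ) + 2 = ((n + 2 - i : ℕ) : ℝ) := by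
    rw [show n + 2 - i = (n - i) + 2 by omega]
    push_cast
    rfl
  simp only [this, Fin.val_castAdd, Fin.val_natAdd]
  ring

theorem integral_chiSquare_mul_det_of_pos (hk : k ≠ 0) :
    ∫ p : ((Fin a → ℝ) × (Fin k → ℝ)) × (Fin k → Fin k → ℝ),
      ((∏ i, p.1.1 i) * ∏ i, √(p.1.2 i)) * (Matrix.of p.2).det
        ∂(((Measure.pi fun i : Fin a => chiSquareMeasure (n - i)).prod
        (Measure.pi fun i : Fin k => chiSquareMeasure (n - (a + i)))).prod
        (Measure.pi fun _ : Fin k => Measure.pi fun _ : Fin k => gaussianReal 0 1)) = 0 := by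
  rw [integral_prod_mul (fun q : (Fin a → ℝ) × (Fin k → ℝ) => (∏ i, q.1 i) * ∏ i, √(q.2 i))
      (fun Z : Fin k → Fin k → ℝ => (Matrix.of Z).det), integral_det_gaussian hk, mul_zero]

theorem integral_chiSquare_mul_det_of_eq_zero (h : a ≤ n) (hk : k = 0) :
    ∫ p : ((Fin a → ℝ) × (Fin k → ℝ)) × (Fin k → Fin k → ℝ),
      ((∏ i, p.1.1 i) * ∏ i, √(p.1.2 i)) * (Matrix.of p.2).det
        ∂(((Measure.pi fun i : Fin a => chiSquareMeasure (n - i)).prod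
        (Measure.pi fun i : Fin k => chiSquareMeasure (n - (a + i)))).prod
        (Measure.pi fun _ : Fin k => Measure.pi fun _ : Fin k => gaussianReal 0 1)) =
      (n ! : ℝ) / ((n - a)! : ℝ) := by
  subst hk
  rw [integral_prod_mul (fun q : (Fin a → ℝ) × (Fin 0 → ℝ) => (∏ i, q.1 i) * ∏ i, √(q.2 i))
      (fun Z : Fin 0 → Fin 0 → ℝ => (Matrix.of Z).det),
    integral_prod_mul (fun u : Fin a → ℝ => ∏ i, u i) (fun v : Fin 0 → ℝ => ∏ i, √(v i)),
    integral_fintype_prod_eq_prod (fun _ x => x)]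
  simp_rw [integral_chiSquareMeasure]
  simp [prod_natCast_sub n a h]

end Moments

/-! ### From the Wishart matrix to Gaussian rows, and reordering of the minor. -/

section Wishart

theorem measurePreserving_ofLp_stdGaussian (ι : Type*) [Fintype ι] :
    MeasurePreserving (WithLp.ofLp : EuclideanSpace ℝ ι → ι → ℝ)
      (stdGaussian (EuclideanSpace ℝ ι)) (Measure.pi fun _ => gaussianReal 0 1) where
  measurable := by fun_prop
  map_eq := by
    rw [← map_pi_eq_stdGaussian, Measure.map_map (by fun_prop) (by fun_prop)]
    exact Measure.map_id

theorem measurable_gram (r n : ℕ) :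
    Measurable fun X : Fin r → EuclideanSpace ℝ (Fin n) => Matrix.gram ℝ X :=
  measurable_pi_iff.2 fun i => measurable_pi_iff.2 fun j => by
    simp only [Matrix.gram_apply]
    fun_prop

theorem measurable_minorDet {r m : ℕ} (I J : Finset (Fin r)) (hI : I.card = m) (hJ : J.card = m) :
    Measurable fun W : Matrix (Fin r) (Fin r) ℝ => minorDet W I J hI hJ := by
  have hW (i j) : Measurable fun W : Matrix (Fin r) (Fin r) ℝ => W i j :=
    (measurable_pi_apply j).comp (measurable_pi_apply i)
  simp only [minorDet, Matrix.det_apply, Matrix.submatrix_apply]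
  fun_prop

/-- The standard Wishart distribution is the law of the Gram matrix of independent standard
Gaussian vectors, the rows of the data matrix. -/
theorem wishartMeasure_one_eq_map_gram (r n : ℕ) :
    wishartMeasure r n 1 =
      (Measure.pi fun _ : Fin r => stdGaussian (EuclideanSpace ℝ (Fin n))).map
        fun X => Matrix.gram ℝ X := by
  have hm : MeasurePreserving
      (fun (x : Fin n → EuclideanSpace ℝ (Fin r)) i => WithLp.toLp 2 fun k => x k i)
      (Measure.pi fun _ => stdGaussian (EuclideanSpace ℝ (Fin r)))
      (Measure.pi fun _ => stdGaussian (EuclideanSpace ℝ (Fin n))) :=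
    (measurePreserving_rows (Fin r) (Fin n)).comp ((measurePreserving_pi_swap _).comp
      (measurePreserving_pi_map fun _ => measurePreserving_ofLp_stdGaussian (Fin r)))
  rw [wishartMeasure, multivariateGaussian_zero_one, ← hm.map_eq,
    Measure.map_map (measurable_gram r n) hm.measurable]
  congr 1
  funext x
  ext i j
  simp [Matrix.mul_apply, Matrix.gram_apply, PiLp.inner_apply, mul_comm]

theorem exists_equiv_of_range_eq {α β γ : Type*} {f : α → γ} {g : β → γ}
    (hf : Function.Injective f) (hg : Function.Injective g) (h : Set.range f = Set.range g) :
    ∃ e : α ≃ β, ∀ a, g (e a) = f a := by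
  refine ⟨(Equiv.ofInjective f hf).trans ((Equiv.setCongr h).trans (Equiv.ofInjective g hg).symm),
    fun a => ?_⟩
  exact congrArg Subtype.val ((Equiv.ofInjective g hg).apply_symm_apply
    (Equiv.setCongr h (Equiv.ofInjective f hf a)))

/-- Up to a sign, a minor can be computed by listing first the indices that are common to the rows
and columns. -/
theorem exists_minorDet_eq {r m c : ℕ} (I J : Finset (Fin r)) (hI : I.card = m) (hJ : J.card = m)
    (hc : (I ∩ J).card = c) :
    ∃ (s : (Fin c ⊕ Fin (m - c)) ⊕ Fin (m - c) → Fin r) (ε : ℝ), Function.Injective s ∧ |ε| = 1 ∧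
      (m - c = 0 → ε = 1) ∧ ∀ A : Matrix (Fin r) (Fin r) ℝ, minorDet A I J hI hJ =
        ε * (Matrix.of fun i j => A (Sum.elim (fun i => s (.inl (.inl i))) (fun i => s (.inr i)) i)
          (s (.inl j))).det := by
  have hcm : (I \ J).card = m - c := by
    rw [Finset.card_sdiff, Finset.inter_comm, hI, hc]
  have hcm' : (J \ I).card = m - c := by
    rw [Finset.card_sdiff, hJ, hc]
  set sA := (I ∩ J).orderEmbOfFin hc
  set sB := (I \ J).orderEmbOfFin hcm
  set sC := (J \ I).orderEmbOfFin hcm'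
  have mA (i) : sA i ∈ I ∩ J := Finset.orderEmbOfFin_mem _ _ _
  have mB (i) : sB i ∈ I \ J := Finset.orderEmbOfFin_mem _ _ _
  have mC (i) : sC i ∈ J \ I := Finset.orderEmbOfFin_mem _ _ _
  simp only [Finset.mem_inter, Finset.mem_sdiff] at mA mB mC
  have injI : Function.Injective (Sum.elim sA sB) :=
    sA.injective.sumElim sB.injective fun i j h => (mB j).2 (h ▸ (mA i).2)
  have injJ : Function.Injective (Sum.elim sA sC) :=
    sA.injective.sumElim sC.injective fun i j h => (mC j).2 (h ▸ (mA i).1)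
  have inj : Function.Injective (Sum.elim (Sum.elim sA sC) sB) := by
    refine injJ.sumElim sB.injective ?_
    rintro (i | i) j h
    · exact (mB j).2 (h ▸ (mA i).2)
    · exact (mB j).2 (h ▸ (mC i).1)
  obtain ⟨σ, hσ⟩ := exists_equiv_of_range_eq (I.orderEmbOfFin hI).injective injI (by
    rw [Set.Sum.elim_range, Finset.range_orderEmbOfFin, Finset.range_orderEmbOfFin,
      Finset.range_orderEmbOfFin]
    ext x
    by_cases x ∈ J <;> simp [*])
  obtain ⟨τ, hτ⟩ := exists_equiv_of_range_eq (J.orderEmbOfFin hJ).injective injJ (by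
    rw [Set.Sum.elim_range, Finset.range_orderEmbOfFin, Finset.range_orderEmbOfFin,
      Finset.range_orderEmbOfFin]
    ext x
    by_cases x ∈ I <;> simp [*])
  -- The order `((A, C), B)` reflects that `A` and `C` are fixed while `B` is integrated. The sign
  -- compares the two reorderings, `σ` of the rows and `τ` of the columns.
  refine ⟨Sum.elim (Sum.elim sA sC) sB, (Equiv.Perm.sign (σ.symm.trans τ) : ℤ), inj, ?_, ?_, ?_⟩
  · rcases Int.units_eq_one_or (Equiv.Perm.sign (σ.symm.trans τ)) with h | h <;> simp [h]
  -- If `m = c` then `I = J`, and both reorderings are the same.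
  · intro h0
    have hIJ : I = J := by
      rw [h0, Finset.card_eq_zero, Finset.sdiff_eq_empty_iff_subset] at hcm hcm'
      exact hcm.antisymm hcm'
    subst hIJ
    have hστ : σ = τ := by
      ext1 i
      apply injI
      rw [hσ, ← hτ]
    simp [hστ]
  -- Permuting columns by `τ ∘ σ⁻¹` and reindexing both sides by `σ` puts rows in `σ` order and
  -- columns in `τ` order, both increasing.
  · intro A
    rw [← Matrix.det_permute', ← Matrix.det_submatrix_equiv_self σ, minorDet]
    congr 1
    ext i j
    simp only [Matrix.submatrix_apply, Matrix.of_apply, id]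
    rw [← hσ, ← hτ]
    simp only [Equiv.trans_apply, Equiv.symm_apply_apply, Sum.elim_inl]
    congr 1

/-- The law of a minor of a standard Wishart matrix. -/
theorem map_minorDet_wishartMeasure {r n m c : ℕ} (hmn : m ≤ n) (I J : Finset (Fin r))
    (hI : I.card = m) (hJ : J.card = m) (hc : (I ∩ J).card = c) :
    (wishartMeasure r n 1).map (fun W => minorDet W I J hI hJ) =
      (((Measure.pi fun i : Fin c => chiSquareMeasure (n - i)).prod
        (Measure.pi fun i : Fin (m - c) => chiSquareMeasure (n - (c + i)))).prod
        (Measure.pi fun _ : Fin (m - c) => Measure.pi fun _ : Fin (m - c) =>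
          gaussianReal 0 1)).map
        fun p => ((∏ i, p.1.1 i) * ∏ i, √(p.1.2 i)) * (Matrix.of p.2).det := by
  obtain ⟨s, ε, hs, hε, h0, hdet⟩ := exists_minorDet_eq I J hI hJ hc
  have hcm : c ≤ m := by
    rw [← hc, ← hI]
    exact Finset.card_le_card Finset.inter_subset_left
  have key := map_det_cross_gram_prod (E := EuclideanSpace ℝ (Fin n)) (a := c) (k := m - c)
    (by simp; omega) ε hε h0
  simp only [finrank_euclideanSpace, Fintype.card_fin] at key
  have e1 := measurePreserving_pi_comp_injective
    (fun _ : Fin r => stdGaussian (EuclideanSpace ℝ (Fin n))) hs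
  have e2 := measurePreserving_pi_sum
    (fun _ : (Fin c ⊕ Fin (m - c)) ⊕ Fin (m - c) => stdGaussian (EuclideanSpace ℝ (Fin n)))
  have e3 := measurePreserving_pi_sum
    (fun _ : Fin c ⊕ Fin (m - c) => stdGaussian (EuclideanSpace ℝ (Fin n)))
  have e := ((e3.prod (.id (Measure.pi fun _ : Fin (m - c) =>
    stdGaussian (EuclideanSpace ℝ (Fin n))))).comp e2).comp e1
  rw [← key, ← e.map_eq, wishartMeasure_one_eq_map_gram,
    Measure.map_map (measurable_minorDet I J hI hJ) (measurable_gram r n),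
    Measure.map_map (measurable_det_cross_gram ε) e.measurable]
  congr 1
  funext X
  rw [Function.comp_apply, hdet]
  simp only [Function.comp_apply]
  congr 3
  ext i j
  rcases i with i | i <;> rcases j with j | j <;> rfl

end Wishart

/-! ### Splitting the chi-square family at index `c`, and the main theorem. -/

theorem measurePreserving_pi_split {m c : ℕ} (hcm : c ≤ m) {X : Type*} [MeasurableSpace X]
    (μ : ℕ → Measure X) [∀ i, IsProbabilityMeasure (μ i)] :
    MeasurePreserving (fun (x : Fin m → X) =>
        ((fun i : Fin c => x ⟨i, by omega⟩), fun i : Fin (m - c) => x ⟨c + i, by omega⟩))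
      (Measure.pi fun i : Fin m => μ i)
      ((Measure.pi fun i : Fin c => μ i).prod (Measure.pi fun i : Fin (m - c) => μ (c + i))) := by
  let e : Fin c ⊕ Fin (m - c) → Fin m :=
    Sum.elim (fun i => ⟨i, by omega⟩) fun i => ⟨c + i, by omega⟩
  have he : Function.Injective e := by
    rintro (i | i) (j | j) h <;> simp [e, Fin.ext_iff] at h ⊢ <;> omega
  exact (measurePreserving_pi_sum fun i => μ (e i : Fin m)).comp
    (measurePreserving_pi_comp_injective (fun i : Fin m => μ i) he)

theorem prod_filter_val_lt {m c : ℕ} (hcm : c ≤ m) {M : Type*} [CommMonoid M] (f : Fin m → M) :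
    ∏ i ∈ Finset.univ.filter (fun i : Fin m => i.val < c), f i =
      ∏ i : Fin c, f ⟨i, by omega⟩ :=
  Finset.prod_bij' (fun i hi => ⟨i, (Finset.mem_filter.1 hi).2⟩) (fun i _ => ⟨i, by omega⟩)
    (by simp) (by simp) (by simp) (by simp) (by simp)

theorem prod_filter_le_val {m c : ℕ} {M : Type*} [CommMonoid M] (f : Fin m → M) :
    ∏ i ∈ Finset.univ.filter (fun i : Fin m => c ≤ i.val), f i =
      ∏ i : Fin (m - c), f ⟨c + i, by omega⟩ :=
  Finset.prod_bij' (fun i hi => ⟨i - c, by have := (Finset.mem_filter.1 hi).2; omega⟩)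
    (fun i _ => ⟨c + i, by omega⟩) (by simp) (by simp)
    (fun i hi => by ext; have := (Finset.mem_filter.1 hi).2; simp; omega)
    (by simp)
    (fun i hi => by
      congr 1; ext; have := (Finset.mem_filter.1 hi).2; simp; omega)

/-- The index `i : Fin m` is `0`-based, so that `V i` is the `(i+1)`-st chi-square variable, which has
`n - (i+1) + 1 = n - i` degrees of freedom. -/
theorem theorem4p4 {r n m c : ℕ} (hmn : m ≤ n) (I J : Finset (Fin r))
    (hI : I.card = m) (hJ : J.card = m) (hc : (I ∩ J).card = c)
    {Ω : Type*} [MeasurableSpace Ω] (P : Measure Ω) [IsProbabilityMeasure P]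
    (W : Ω → Matrix (Fin r) (Fin r) ℝ) (hW : HasLaw W (wishartMeasure r n 1) P) :
    -- the distribution of the minor
    (∀ {Ω' : Type*} [MeasurableSpace Ω'] (P' : Measure Ω') [IsProbabilityMeasure P']
      (V : Fin m → Ω' → ℝ) (Z : Fin (m - c) → Fin (m - c) → Ω' → ℝ),
      (∀ i, HasLaw (V i) (chiSquareMeasure (n - i)) P') →
      iIndepFun V P' →
      (∀ i j, HasLaw (Z i j) (gaussianReal 0 1) P') →
      iIndepFun (fun (p : Fin (m - c) × Fin (m - c)) ω => Z p.1 p.2 ω) P' →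
      IndepFun (fun ω i => V i ω) (fun ω i j => Z i j ω) P' →
      IdentDistrib (fun ω => minorDet (W ω) I J hI hJ)
        (fun ω => (∏ i ∈ Finset.univ.filter (fun i : Fin m => i.val < c), V i ω) *
            (∏ i ∈ Finset.univ.filter (fun i : Fin m => c ≤ i.val), √(V i ω)) *
            (Matrix.of fun i j => Z i j ω).det) P P') ∧
    -- the second moment and the variance, which are finite
    MemLp (fun ω => minorDet (W ω) I J hI hJ) 2 P ∧
    ∫ ω, minorDet (W ω) I J hI hJ ^ 2 ∂P =
      (n ! : ℝ) / ((n - m)! : ℝ) * (((n + 2)! : ℝ) / ((n + 2 - c)! : ℝ)) * ((m - c)! : ℝ) ∧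
    (I = J → Var[fun ω => minorDet (W ω) I J hI hJ; P] =
      (n ! : ℝ) / ((n - m)! : ℝ) *
        (((n + 2)! : ℝ) / ((n + 2 - m)! : ℝ) - (n ! : ℝ) / ((n - m)! : ℝ))) ∧
    (c < m → Var[fun ω => minorDet (W ω) I J hI hJ; P] =
      (n ! : ℝ) / ((n - m)! : ℝ) * (((n + 2)! : ℝ) / ((n + 2 - c)! : ℝ)) * ((m - c)! : ℝ)) := by
  have hcm : c ≤ m := by
    rw [← hc, ← hI]
    exact Finset.card_le_card Finset.inter_subset_left
  set Q := ((Measure.pi fun i : Fin c => chiSquareMeasure (n - i)).prod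
    (Measure.pi fun i : Fin (m - c) => chiSquareMeasure (n - (c + i)))).prod
    (Measure.pi fun _ : Fin (m - c) => Measure.pi fun _ : Fin (m - c) => gaussianReal 0 1) with hQ
  have hF := measurable_chiSquare_mul_det (ι := Fin c) (κ := Fin (m - c))
  have hmin := measurable_minorDet I J hI hJ
  -- All moments are transferred from the explicit model `Q`, so no variables `V`, `Z` need to be
  -- given for them.
  have hid : IdentDistrib (fun ω => minorDet (W ω) I J hI hJ)
      (fun p : ((Fin c → ℝ) × (Fin (m - c) → ℝ)) × (Fin (m - c) → Fin (m - c) → ℝ) =>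
        ((∏ i, p.1.1 i) * ∏ i, √(p.1.2 i)) * (Matrix.of p.2).det) P Q := by
    refine ⟨hmin.comp_aemeasurable hW.aemeasurable, hF.aemeasurable, ?_⟩
    rw [← map_minorDet_wishartMeasure hmn I J hI hJ hc, ← hW.map_eq,
      AEMeasurable.map_map_of_aemeasurable hmin.aemeasurable hW.aemeasurable]
    rfl
  have hL : MemLp (fun ω => minorDet (W ω) I J hI hJ) 2 P :=
    hid.memLp_iff.2 (memLp_two_chiSquare_mul_det n c (m - c))
  have hsq : ∫ ω, minorDet (W ω) I J hI hJ ^ 2 ∂P =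
      (n ! : ℝ) / ((n - m)! : ℝ) * (((n + 2)! : ℝ) / ((n + 2 - c)! : ℝ)) * ((m - c)! : ℝ) := by
    have h1 := (hid.comp (measurable_id.pow_const 2)).integral_eq
    have h2 := integral_sq_chiSquare_mul_det n c (m - c) (by omega)
    rw [Nat.add_sub_cancel' hcm] at h2
    exact h1.trans h2
  have hvar := variance_eq_sub hL
  simp only [Pi.pow_apply, hsq] at hvar
  refine ⟨?_, hL, hsq, ?_, ?_⟩
  · intro Ω' _ P' _ V Z hV hVi hZ hZi hVZ
    have hVm : AEMeasurable (fun ω i => V i ω) P' :=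
      aemeasurable_pi_lambda _ fun i => (hV i).aemeasurable
    have hZm : AEMeasurable (fun ω i j => Z i j ω) P' :=
      aemeasurable_pi_lambda _ fun i => aemeasurable_pi_lambda _ fun j => (hZ i j).aemeasurable
    have hVlaw : P'.map (fun ω i => V i ω) =
        Measure.pi fun i : Fin m => chiSquareMeasure (n - i) := by
      rw [(iIndepFun_iff_map_fun_eq_pi_map fun i => (hV i).aemeasurable).1 hVi]
      simp_rw [(hV _).map_eq]
    have hZlaw : P'.map (fun ω i j => Z i j ω) =
        Measure.pi fun _ => Measure.pi fun _ => gaussianReal 0 1 := by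
      have h := (iIndepFun_iff_map_fun_eq_pi_map fun p : Fin (m - c) × Fin (m - c) =>
        (hZ p.1 p.2).aemeasurable).1 hZi
      simp_rw [(hZ _ _).map_eq] at h
      rw [← (measurePreserving_curry _).map_eq, ← h, AEMeasurable.map_map_of_aemeasurable
        (measurePreserving_curry (ι := Fin (m - c)) (κ := Fin (m - c)) (gaussianReal 0 1)
          ).measurable.aemeasurable
        (aemeasurable_pi_lambda _ fun p : Fin (m - c) × Fin (m - c) => (hZ p.1 p.2).aemeasurable)]
      rfl
    have hjoint := (indepFun_iff_map_prod_eq_prod_map_map hVm hZm).1 hVZ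
    rw [hVlaw, hZlaw] at hjoint
    have hsplit := (measurePreserving_pi_split hcm fun i => chiSquareMeasure (n - i)).prod
      (.id (Measure.pi fun _ : Fin (m - c) => Measure.pi fun _ : Fin (m - c) => gaussianReal 0 1))
    simp_rw [prod_filter_val_lt hcm, prod_filter_le_val]
    refine ⟨hid.aemeasurable_fst, (hF.comp hsplit.measurable).comp_aemeasurable (hVm.prodMk hZm),
      ?_⟩
    rw [hid.map_eq, hQ, ← hsplit.map_eq, ← hjoint, Measure.map_map hF hsplit.measurable,
      AEMeasurable.map_map_of_aemeasurable (hF.comp hsplit.measurable).aemeasurable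
        (hVm.prodMk hZm)]
    rfl
  · intro hIJ
    have hcm' : c = m := by rw [← hc, ← hIJ, Finset.inter_self, hI]
    rw [hvar, hid.integral_eq, integral_chiSquare_mul_det_of_eq_zero n c (m - c) (by omega)
      (by omega), hcm']
    simp
    ring
  -- A nonempty Gaussian determinant has mean zero, so the variance is the second moment.
  · intro hlt
    rw [hvar, hid.integral_eq, integral_chiSquare_mul_det_of_pos n c (m - c) (by omega)]
    simp
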